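/- Let $b:\mathbb{R}^d\to\mathbb{R}^d$ and $\sigma:\mathbb{R}^d\to\mathbb{R}^{d\times k}$ be locally Lipschitz with $\sigma\sigma^*$ bounded (possibly degenerate), and let $\{X_t,t\ge 0\}$, under the probability measures $(\mathbb{P}_x)_{x\in\mathbb{R}^d}$, be a (non-exploding, continuous) diffusion process solving $dX_t=b(X_t)\,dt+\sigma(X_t)\,dB_t$, $X_0=x$ under $\mathbb{P}_x$. Write $p(t,x;dy)=\mathbb{P}_x(X_t\in dy)$ and $B_R=\{x\in\mathbb{R}^d:|x|\le R\}$. For $B=B_R$ and $t_B>0$ let $\tau_0=\inf\{t\ge 0:X_t\in B\}$, $\tau_{\ell+1}=\inf\{t\ge\tau_\ell+t_B:X_t\in B\}$, and let $P^B(n,x,dx')$ be the law of $X_{\tau_n}$ under $\mathbb{P}_x$ (on the event $\tau_n<\infty$). Put $$q(R,n)=\inf_{|x|,|x'|\le R}\int_B\min\left\{\frac{P^B(n,x,dx'')}{P^B(n,x',dx'')},1\right\}P^B(n,x',dx''),$$ where the quotient denotes the density of the part of $P^B(n,x,\cdot)$ that is absolutely continuous with respect to $P^B(n,x',\cdot)$.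 The local Doeblin condition $(D_\ell)$ says: for any $R'>0$ there exist $R>R'$, $t_B>0$ and an integer $n_0>0$ such that $q(R,n_0)>0$. The strong local Doeblin condition $(D_{sl})$ says: for each $R>0$ there exist a Borel set $A_R\subset B_R$, $t_R>0$, $c(R)\ge 1$ and a probability measure $\mu$ on $\mathbb{R}^d$ (which may depend on $R$) with $\mu(A_R)>0$ such that, for all $x\in B_R$, with a measurable density $q(t_R,x,\cdot)\ge 0$ and a nonnegative measure $\nu(t_R,x;\cdot)$, $$p(t_R,x;dy)=q(t_R,x,y)\,\mu(dy)+\nu(t_R,x;dy),\qquad \frac1{c(R)}\le q(t_R,x,y)\le c(R)\quad\text{for } y\in A_R .$$ Then $(D_{sl})$ implies $(D_\ell)$. Moreover, whenever $R>0$ and $A_R,t_R,c(R),\mu$ are as in $(D_{sl})$ for this $R$, the process in $B_R$ with $t_B=t_R$ satisfies the bound in $(D_\ell)$ with $n_0=1$ and the lower bound $\mu(A_R)/c(R)$: $$q(R,1)\ \ge\ \frac{\mu(A_R)}{c(R)}\ >\ 0 .$$ -/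

import Mathlib

open MeasureTheory ProbabilityTheory Set
open scoped NNReal ENNReal

noncomputable section

namespace LocalDoeblin

/-- Second order operator `L f = (1/2) ∑ (σ σ*)ᵢⱼ ∂ᵢ∂ⱼ f + ∑ bᵢ ∂ᵢ f`, the generator of
`dX = b(X) dt + σ(X) dB`. -/
def generator {d k : ℕ} (b : EuclideanSpace ℝ (Fin d) → EuclideanSpace ℝ (Fin d))
    (σ : EuclideanSpace ℝ (Fin d) → Matrix (Fin d) (Fin k) ℝ)
    (f : EuclideanSpace ℝ (Fin d) → ℝ) (x : EuclideanSpace ℝ (Fin d)) : ℝ :=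
  (1 / 2 : ℝ) * ∑ i, ∑ j, (σ x * (σ x).transpose) i j *
      iteratedFDeriv ℝ 2 f x ![EuclideanSpace.single i 1, EuclideanSpace.single j 1]
    + ∑ i, b x i * fderiv ℝ f x (EuclideanSpace.single i 1)

/-- `(X, (P x)ₓ)` is the diffusion process with drift `b` and dispersion `σ`: `X` has continuous
paths and, for every `x`, the law of `X` under the probability measure `P x` solves the
Stroock–Varadhan martingale problem for the generator of `dX = b(X) dt + σ(X) dB`, started at `x`
(that is, `X` is under `P x` a weak solution of this equation with `X₀ = x`). -/
structure IsDiffusion {d k : ℕ} {Ω : Type*} [MeasurableSpace Ω]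
    (b : EuclideanSpace ℝ (Fin d) → EuclideanSpace ℝ (Fin d))
    (σ : EuclideanSpace ℝ (Fin d) → Matrix (Fin d) (Fin k) ℝ)
    (X : ℝ≥0 → Ω → EuclideanSpace ℝ (Fin d))
    (P : EuclideanSpace ℝ (Fin d) → Measure Ω) : Prop where
  measurable : ∀ t, StronglyMeasurable (X t)
  continuous_paths : ∀ ω, Continuous fun t => X t ω
  isProbabilityMeasure : ∀ x, IsProbabilityMeasure (P x)
  initial : ∀ x, ∀ᵐ ω ∂(P x), X 0 ω = x
  martingale : ∀ x, ∀ f : EuclideanSpace ℝ (Fin d) → ℝ, ContDiff ℝ (⊤ : ℕ∞) f → HasCompactSupport f →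
    Martingale
      (fun (t : ℝ≥0) ω => f (X t ω) - ∫ s in (0 : ℝ)..t, generator b σ f (X s.toNNReal ω))
      (Filtration.natural X measurable) (P x)

/-- The transition probability `p(t, x; dy)`, the law of `X_t` under `P x`. -/
def transition {E Ω : Type*} [MeasurableSpace E] [MeasurableSpace Ω]
    (X : ℝ≥0 → Ω → E) (P : E → Measure Ω) (t : ℝ≥0) (x : E) : Measure E :=
  (P x).map (X t)

/-- The times `τ₀ = inf {t ≥ 0 : w t ∈ B}`, `τ_{ℓ+1} = inf {t ≥ τ_ℓ + t_B : w t ∈ B}` of a path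
`w`, with value `∞` if there is no such `t`. -/
def returnTime {E : Type*} (B : Set E) (tB : ℝ≥0) (w : ℝ≥0 → E) : ℕ → ℝ≥0∞
  | 0 => ⨅ (t : ℝ≥0) (_ : w t ∈ B), (t : ℝ≥0∞)
  | n + 1 => ⨅ (t : ℝ≥0) (_ : returnTime B tB w n + tB ≤ t ∧ w t ∈ B), (t : ℝ≥0∞)

/-- The `n`-step transition probability `P^B(n, x, dx')` of the process in `B`: the law under
`P x` of `X` at time `τₙ`, on the event `τₙ < ∞` on which it is defined. -/
def processIn {E Ω : Type*} [MeasurableSpace E] [MeasurableSpace Ω]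
    (X : ℝ≥0 → Ω → E) (P : E → Measure Ω) (B : Set E) (tB : ℝ≥0) (n : ℕ) (x : E) : Measure E :=
  ((P x).restrict {ω | returnTime B tB (fun t => X t ω) n < ∞}).map
    fun ω => X (returnTime B tB (fun t => X t ω) n).toNNReal ω

/-- The quantity
`q(R, n) = inf_{|x|, |x'| ≤ R} ∫_B min {P^B(n, x, dx'') / P^B(n, x', dx''), 1} P^B(n, x', dx'')`
for `B = {|x| ≤ R}`, where the quotient is the density of the absolutely continuous part. -/
def doeblinConst {d : ℕ} {Ω : Type*} [MeasurableSpace Ω]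
    (X : ℝ≥0 → Ω → EuclideanSpace ℝ (Fin d)) (P : EuclideanSpace ℝ (Fin d) → Measure Ω)
    (R : ℝ) (tB : ℝ≥0) (n : ℕ) : ℝ≥0∞ :=
  ⨅ (x ∈ Metric.closedBall 0 R) (x' ∈ Metric.closedBall 0 R),
    ∫⁻ y in Metric.closedBall 0 R,
      min ((processIn X P (Metric.closedBall 0 R) tB n x).rnDeriv
        (processIn X P (Metric.closedBall 0 R) tB n x') y) 1
      ∂(processIn X P (Metric.closedBall 0 R) tB n x')

/-- The local Doeblin condition. -/
def LocalDoeblinCondition {d : ℕ} {Ω : Type*} [MeasurableSpace Ω]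
    (X : ℝ≥0 → Ω → EuclideanSpace ℝ (Fin d)) (P : EuclideanSpace ℝ (Fin d) → Measure Ω) : Prop :=
  ∀ R' : ℝ, 0 < R' → ∃ R : ℝ, R' < R ∧ ∃ tB : ℝ≥0, 0 < tB ∧ ∃ n₀ : ℕ, 0 < n₀ ∧
    0 < doeblinConst X P R tB n₀

/-- The set `A`, the time `t`, the constant `c` and the probability measure `μ` are as the strong
local Doeblin condition demands for the radius `R`: `A` is a Borel subset of `{|x| ≤ R}` with
`μ A > 0`, `t > 0`, `c ≥ 1`, and for all `|x| ≤ R`,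
`p(t, x; dy) = q(t, x, y) μ(dy) + ν(t, x; dy)` with `1/c ≤ q(t, x, y) ≤ c` for `y ∈ A`. -/
structure IsStrongDoeblinAt {d : ℕ} {Ω : Type*} [MeasurableSpace Ω]
    (X : ℝ≥0 → Ω → EuclideanSpace ℝ (Fin d)) (P : EuclideanSpace ℝ (Fin d) → Measure Ω)
    (R : ℝ) (A : Set (EuclideanSpace ℝ (Fin d))) (t c : ℝ≥0)
    (μ : Measure (EuclideanSpace ℝ (Fin d))) : Prop where
  measurableSet : MeasurableSet A
  subset : A ⊆ Metric.closedBall 0 R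
  time_pos : 0 < t
  one_le : 1 ≤ c
  isProbabilityMeasure : IsProbabilityMeasure μ
  measure_pos : 0 < μ A
  decomposition : ∀ x ∈ Metric.closedBall (0 : EuclideanSpace ℝ (Fin d)) R,
    ∃ (q : EuclideanSpace ℝ (Fin d) → ℝ≥0∞) (ν : Measure (EuclideanSpace ℝ (Fin d))),
      Measurable q ∧ transition X P t x = μ.withDensity q + ν ∧
      ∀ y ∈ A, 1 / (c : ℝ≥0∞) ≤ q y ∧ q y ≤ c

/-- The strong local Doeblin condition. -/
def StrongLocalDoeblinCondition {d : ℕ} {Ω : Type*} [MeasurableSpace Ω]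
    (X : ℝ≥0 → Ω → EuclideanSpace ℝ (Fin d)) (P : EuclideanSpace ℝ (Fin d) → Measure Ω) : Prop :=
  ∀ R : ℝ, 0 < R → ∃ A t c μ, IsStrongDoeblinAt X P R A t c μ

end LocalDoeblin

end

/-! A path that starts in the ball `B` has `τ₀ = 0`; if it is also in `B` at time `t_B`, then `τ₁`
is exactly `t_B`. Hence the one-step law of the process in `B` dominates `p(t_B, x; ·)` restricted
to `B`, and so, after dropping `ν`, the measure `m = c⁻¹ μ|_A`, which is the same for every starting
point in `B` (`IsStrongDoeblinAt.smul_restrict_le_processIn`). Two finite measures that both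
dominate `m` overlap on `B` by at least `m(B) = μ(A) / c` (`le_setLIntegral_min_rnDeriv`). The
delicate point is measurability of `X` at time `τ₁`, obtained from continuity of paths and
closedness of `B`. -/

namespace LocalDoeblin

section HittingTime

variable {E Ω : Type*} [PseudoEMetricSpace E]

/-- The admissible times form a closed set, so the infimum is attained unless it is `∞`. -/
theorem iInf_coe_le_coe_iff_exists {w : ℝ≥0 → E} (hw : Continuous w) {B : Set E}
    (hB : IsClosed B) (s u : ℝ≥0) :
    (⨅ (t : ℝ≥0) (_ : s ≤ t ∧ w t ∈ B), (t : ℝ≥0∞)) ≤ u ↔ ∃ t ∈ Icc s u, w t ∈ B := by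
  constructor
  · intro h
    have hK : IsClosed {t : ℝ≥0 | s ≤ t ∧ w t ∈ B} :=
      isClosed_Ici.inter (hB.preimage hw)
    rcases eq_empty_or_nonempty {t : ℝ≥0 | s ≤ t ∧ w t ∈ B} with hE | hne
    · have htop : (⨅ (t : ℝ≥0) (_ : s ≤ t ∧ w t ∈ B), (t : ℝ≥0∞)) = ⊤ := by
        simp only [iInf_eq_top]
        intro t ht
        exact absurd ht (eq_empty_iff_forall_notMem.1 hE t)
      rw [htop] at h
      exact absurd h (by simp)
    · have hmem := hK.csInf_mem hne (OrderBot.bddBelow _)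
      have heq : ((sInf {t : ℝ≥0 | s ≤ t ∧ w t ∈ B} : ℝ≥0) : ℝ≥0∞) =
          ⨅ (t : ℝ≥0) (_ : s ≤ t ∧ w t ∈ B), (t : ℝ≥0∞) := ENNReal.coe_sInf hne
      rw [← heq, ENNReal.coe_le_coe] at h
      exact ⟨_, ⟨hmem.1, h⟩, hmem.2⟩
  · rintro ⟨t, ⟨hst, htu⟩, ht⟩
    exact (iInf₂_le t ⟨hst, ht⟩).trans (ENNReal.coe_le_coe.2 htu)

/-- The distance to `B` attains its minimum on the compact interval, and approximation along `D`
forces that minimum to be zero. With `D` countable, hitting becomes an event determined by countably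
many times. -/
theorem exists_mem_iff_forall_exists_infEDist_lt {w : ℝ≥0 → E} (hw : Continuous w) {B : Set E}
    (hB : IsClosed B) {s u : ℝ≥0} {D : Set (Icc s u)} (hD : Dense D) (hsu : s ≤ u) :
    (∃ t ∈ Icc s u, w t ∈ B) ↔ ∀ n : ℕ, ∃ r ∈ D, Metric.infEDist (w r) B < (n : ℝ≥0∞)⁻¹ := by
  have hf : Continuous fun t : Icc s u => Metric.infEDist (w t) B :=
    Metric.continuous_infEDist.comp (hw.comp continuous_subtype_val)
  constructor
  · rintro ⟨t, htI, ht⟩ n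
    obtain ⟨r, hr, hrD⟩ := hD.inter_open_nonempty
      {t : Icc s u | Metric.infEDist (w t) B < (n : ℝ≥0∞)⁻¹} (isOpen_lt hf continuous_const)
      ⟨⟨t, htI⟩, by simp [Metric.infEDist_zero_of_mem ht]⟩
    exact ⟨r, hrD, hr⟩
  · intro h
    have : Nonempty (Icc s u) := ⟨⟨s, le_rfl, hsu⟩⟩
    obtain ⟨t, -, ht⟩ := isCompact_univ.exists_isMinOn univ_nonempty hf.continuousOn
    refine ⟨t, t.2, ?_⟩
    rw [← hB.closure_eq, Metric.mem_closure_iff_infEDist_zero]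
    by_contra h0
    obtain ⟨n, hn⟩ := ENNReal.exists_inv_nat_lt h0
    obtain ⟨r, -, hr⟩ := h n
    exact absurd (ht (mem_univ r)) (not_le.2 (hr.trans hn))

theorem measurable_hittingTime_of_isClosed [MeasurableSpace Ω] [MeasurableSpace E]
    [OpensMeasurableSpace E] {X : ℝ≥0 → Ω → E} (hX : ∀ t, Measurable (X t))
    (hc : ∀ ω, Continuous fun t => X t ω) {B : Set E} (hB : IsClosed B) (s : ℝ≥0) :
    Measurable fun ω => ⨅ (t : ℝ≥0) (_ : s ≤ t ∧ X t ω ∈ B), (t : ℝ≥0∞) := by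
  refine measurable_of_Iic fun a => ?_
  induction a using ENNReal.recTopCoe with
  | top => simp
  | coe u =>
    have hset : (fun ω => ⨅ (t : ℝ≥0) (_ : s ≤ t ∧ X t ω ∈ B), (t : ℝ≥0∞)) ⁻¹' Iic (u : ℝ≥0∞) =
        {ω | ∃ t ∈ Icc s u, X t ω ∈ B} := by
      ext ω
      exact iInf_coe_le_coe_iff_exists (hc ω) hB s u
    rw [hset]
    by_cases hsu : s ≤ u
    · obtain ⟨D, hDc, hD⟩ := TopologicalSpace.exists_countable_dense (Icc s u)
      have : {ω | ∃ t ∈ Icc s u, X t ω ∈ B} =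
          ⋂ n : ℕ, ⋃ r ∈ D, {ω | Metric.infEDist (X r ω) B < (n : ℝ≥0∞)⁻¹} := by
        ext ω
        simp only [mem_iInter, mem_iUnion, mem_ofPred_eq, exists_prop]
        exact exists_mem_iff_forall_exists_infEDist_lt (hc ω) hB hD hsu
      rw [this]
      exact MeasurableSet.iInter fun n => MeasurableSet.biUnion hDc fun r _ =>
        measurableSet_lt (measurable_infEDist.comp (hX r)) measurable_const
    · simp [Icc_eq_empty hsu]

end HittingTime

section ReturnTime

variable {E : Type*} {B : Set E} {w : ℝ≥0 → E}

theorem returnTime_zero_of_mem (tB : ℝ≥0) (h : w 0 ∈ B) : returnTime B tB w 0 = 0 :=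
  le_antisymm (iInf₂_le (0 : ℝ≥0) h) zero_le

theorem returnTime_one_of_mem (tB : ℝ≥0) (h : w 0 ∈ B) :
    returnTime B tB w 1 = ⨅ (t : ℝ≥0) (_ : tB ≤ t ∧ w t ∈ B), (t : ℝ≥0∞) := by
  rw [returnTime, returnTime_zero_of_mem tB h]
  simp only [zero_add, ENNReal.coe_le_coe]

theorem returnTime_one_of_mem_of_mem {tB : ℝ≥0} (h : w 0 ∈ B) (h' : w tB ∈ B) :
    returnTime B tB w 1 = tB := by
  rw [returnTime_one_of_mem tB h]
  exact le_antisymm (iInf₂_le tB ⟨le_rfl, h'⟩)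
    (le_iInf₂ fun t ht => ENNReal.coe_le_coe.2 ht.1)

end ReturnTime

section ProcessIn

variable {E Ω : Type*} [MeasurableSpace Ω] {X : ℝ≥0 → Ω → E}
  {B : Set E}

/-- Needed because `Measure.map` is zero along a map that is not a.e. measurable. For almost every
path, the return time is the first hitting time of `B` after `tB`, and `X` is jointly measurable in
time and `ω`. -/
theorem aemeasurable_eval_returnTime_one [PseudoEMetricSpace E] [MeasurableSpace E] [BorelSpace E]
    {Q : Measure Ω} (hX : ∀ t, StronglyMeasurable (X t))
    (hc : ∀ ω, Continuous fun t => X t ω) (hB : IsClosed B) (h0 : ∀ᵐ ω ∂Q, X 0 ω ∈ B)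
    (tB : ℝ≥0) :
    AEMeasurable (fun ω => X (returnTime B tB (fun t => X t ω) 1).toNNReal ω) Q := by
  have hT := (measurable_hittingTime_of_isClosed (fun t => (hX t).measurable) hc hB tB).ennreal_toNNReal
  have hXm : Measurable (Function.uncurry X) :=
    (stronglyMeasurable_uncurry_of_continuous_of_stronglyMeasurable hc hX).measurable
  refine ⟨_, hXm.comp (hT.prodMk measurable_id), ?_⟩
  filter_upwards [h0] with ω hω
  rw [returnTime_one_of_mem tB hω]
  rfl

theorem transition_restrict_le_processIn [PseudoEMetricSpace E] [MeasurableSpace E] [BorelSpace E]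
    {P : E → Measure Ω} (hX : ∀ t, StronglyMeasurable (X t))
    (hc : ∀ ω, Continuous fun t => X t ω) (hB : IsClosed B) {x : E}
    (h0 : ∀ᵐ ω ∂(P x), X 0 ω ∈ B) (tB : ℝ≥0) :
    (transition X P tB x).restrict B ≤ processIn X P B tB 1 x := by
  refine Measure.le_iff.2 fun S hS => ?_
  rw [Measure.restrict_apply hS, transition,
    Measure.map_apply (hX tB).measurable (hS.inter hB.measurableSet), processIn,
    Measure.map_apply_of_aemeasurable
      ((aemeasurable_eval_returnTime_one hX hc hB h0 tB).mono_measure Measure.restrict_le_self) hS]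
  -- Paths in `B` at time `tB` return exactly then; later returns can only add mass.
  refine le_trans (measure_mono_ae ?_) (Measure.le_restrict_apply _ _)
  filter_upwards [h0] with ω hω hmem
  have hτ : returnTime B tB (fun t => X t ω) 1 = tB := returnTime_one_of_mem_of_mem hω hmem.2
  refine ⟨?_, ?_⟩
  · change X (returnTime B tB (fun t => X t ω) 1).toNNReal ω ∈ S
    rw [hτ]
    exact hmem.1
  · change returnTime B tB (fun t => X t ω) 1 < ∞
    rw [hτ]
    exact ENNReal.coe_lt_top

instance isFiniteMeasure_processIn [MeasurableSpace E] {P : E → Measure Ω} {tB : ℝ≥0} {n : ℕ}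
    {x : E} [IsFiniteMeasure (P x)] : IsFiniteMeasure (processIn X P B tB n x) := by
  unfold processIn
  infer_instance

end ProcessIn

section Density

variable {E : Type*} [MeasurableSpace E]

/-- Densities are additive along `π = (π - m) + m`. -/
theorem rnDeriv_le_rnDeriv_of_le {m π π' : Measure E} [IsFiniteMeasure π] [IsFiniteMeasure π']
    (h : m ≤ π) : m.rnDeriv π' ≤ᵐ[π'] π.rnDeriv π' := by
  have : IsFiniteMeasure m := isFiniteMeasure_of_le π h
  have : IsFiniteMeasure (π - m) := isFiniteMeasure_of_le π Measure.sub_le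
  have := Measure.rnDeriv_add (π - m) m π'
  rw [Measure.sub_add_cancel_of_le h] at this
  filter_upwards [this] with y hy
  rw [hy]
  exact le_add_self

/-- Two finite measures overlap at least as much as any measure which they both dominate. -/
theorem le_setLIntegral_min_rnDeriv {m π π' : Measure E} [IsFiniteMeasure π] [IsFiniteMeasure π']
    (h : m ≤ π) (h' : m ≤ π') (s : Set E) : m s ≤ ∫⁻ y in s, min (π.rnDeriv π' y) 1 ∂π' := by
  have : IsFiniteMeasure m := isFiniteMeasure_of_le π h
  -- Since `m ≤ π'`, `m` has no part singular to `π'`, so its density carries all its mass; that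
  -- density is at most `dπ/dπ'` and at most `dπ'/dπ' = 1`.
  rw [← Measure.setLIntegral_rnDeriv (Measure.absolutelyContinuous_of_le h') s]
  refine lintegral_mono_ae (ae_restrict_of_ae ?_)
  filter_upwards [rnDeriv_le_rnDeriv_of_le (π' := π') h, rnDeriv_le_rnDeriv_of_le (π' := π') h',
    Measure.rnDeriv_self π'] with y h1 h2 h3
  exact le_min h1 (h2.trans h3.le)

theorem smul_restrict_le_withDensity {μ : Measure E} {A : Set E} (hA : MeasurableSet A)
    {a : ℝ≥0∞} {q : E → ℝ≥0∞} (hq : ∀ y ∈ A, a ≤ q y) :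
    a • μ.restrict A ≤ (μ.withDensity q).restrict A := by
  rw [restrict_withDensity hA, ← withDensity_const]
  exact withDensity_mono ((ae_restrict_iff' hA).2 (.of_forall hq))

end Density

section Doeblin

variable {d k : ℕ} {Ω : Type*} [MeasurableSpace Ω]
  {b : EuclideanSpace ℝ (Fin d) → EuclideanSpace ℝ (Fin d)}
  {σ : EuclideanSpace ℝ (Fin d) → Matrix (Fin d) (Fin k) ℝ}
  {X : ℝ≥0 → Ω → EuclideanSpace ℝ (Fin d)} {P : EuclideanSpace ℝ (Fin d) → Measure Ω}
  {R : ℝ} {A : Set (EuclideanSpace ℝ (Fin d))} {t c : ℝ≥0}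
  {μ : Measure (EuclideanSpace ℝ (Fin d))}

theorem IsStrongDoeblinAt.smul_restrict_le_processIn (h : IsStrongDoeblinAt X P R A t c μ)
    (hX : IsDiffusion b σ X P) {x : EuclideanSpace ℝ (Fin d)} (hx : x ∈ Metric.closedBall 0 R) :
    (c : ℝ≥0∞)⁻¹ • μ.restrict A ≤ processIn X P (Metric.closedBall 0 R) t 1 x := by
  obtain ⟨q, ν, -, hp, hqA⟩ := h.decomposition x hx
  have h0 : ∀ᵐ ω ∂(P x), X 0 ω ∈ Metric.closedBall 0 R := by
    filter_upwards [hX.initial x] with ω hω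
    rwa [hω]
  calc (c : ℝ≥0∞)⁻¹ • μ.restrict A
      ≤ (μ.withDensity q).restrict A :=
        smul_restrict_le_withDensity h.measurableSet fun y hy => by
          simpa only [one_div] using (hqA y hy).1
    _ ≤ (transition X P t x).restrict (Metric.closedBall 0 R) := by
        rw [hp]
        exact Measure.restrict_mono h.subset (Measure.le_add_right le_rfl)
    _ ≤ _ := transition_restrict_le_processIn hX.measurable hX.continuous_paths
        Metric.isClosed_closedBall h0 t

theorem IsStrongDoeblinAt.le_doeblinConst (h : IsStrongDoeblinAt X P R A t c μ)
    (hX : IsDiffusion b σ X P) : μ A / c ≤ doeblinConst X P R t 1 := by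
  have := hX.isProbabilityMeasure
  refine le_iInf₂ fun x hx => le_iInf₂ fun x' hx' => ?_
  refine le_trans (le_of_eq ?_) (le_setLIntegral_min_rnDeriv
    (h.smul_restrict_le_processIn hX hx) (h.smul_restrict_le_processIn hX hx') _)
  -- As `A` lies in the ball, the common minorant gives the ball mass `μ A / c`.
  rw [Measure.smul_apply, Measure.restrict_apply' h.measurableSet,
    inter_eq_right.2 h.subset, smul_eq_mul, ENNReal.div_eq_inv_mul]

theorem IsStrongDoeblinAt.div_pos (h : IsStrongDoeblinAt X P R A t c μ) : 0 < μ A / c :=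
  ENNReal.div_pos h.measure_pos.ne' ENNReal.coe_ne_top

end Doeblin

end LocalDoeblin

theorem proposition4 {d k : ℕ} {Ω : Type*} [MeasurableSpace Ω]
    (b : EuclideanSpace ℝ (Fin d) → EuclideanSpace ℝ (Fin d))
    (σ : EuclideanSpace ℝ (Fin d) → Matrix (Fin d) (Fin k) ℝ)
    (hb : LocallyLipschitz b) (hσ : ∀ i j, LocallyLipschitz fun x => σ x i j)
    (hbdd : ∃ K : ℝ, ∀ x i j, |(σ x * (σ x).transpose) i j| ≤ K)
    (X : ℝ≥0 → Ω → EuclideanSpace ℝ (Fin d))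
    (P : EuclideanSpace ℝ (Fin d) → Measure Ω)
    (hX : LocalDoeblin.IsDiffusion b σ X P) :
    (LocalDoeblin.StrongLocalDoeblinCondition X P → LocalDoeblin.LocalDoeblinCondition X P) ∧
    ∀ (R : ℝ) (A : Set (EuclideanSpace ℝ (Fin d))) (t c : ℝ≥0)
      (μ : Measure (EuclideanSpace ℝ (Fin d))), 0 < R →
      LocalDoeblin.IsStrongDoeblinAt X P R A t c μ →
      0 < μ A / c ∧ μ A / c ≤ LocalDoeblin.doeblinConst X P R t 1 := by
  refine ⟨fun hsl R' hR' => ?_, fun R A t c μ _ h => ⟨h.div_pos, h.le_doeblinConst hX⟩⟩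
  obtain ⟨A, t, c, μ, h⟩ := hsl (R' + 1) (by linarith)
  exact ⟨R' + 1, lt_add_one R', t, h.time_pos, 1, one_pos,
    h.div_pos.trans_le (h.le_doeblinConst hX)⟩
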